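/- Let $(M,J,g)$ be a $2n$-dimensional almost complex manifold with Norden metric, i.e. $M$ is a smooth $2n$-dimensional manifold, $J$ is a smooth almost complex structure ($J^2=-\mathrm{id}$) and $g$ is a smooth pseudo-Riemannian (symmetric, nondegenerate) metric with $g(JX,JY)=-g(X,Y)$. Let $\nabla$ be the Levi-Civita connection of $g$, $F(X,Y,Z)=g((\nabla_XJ)Y,Z)$, $R(X,Y)Z=\nabla_X\nabla_YZ-\nabla_Y\nabla_XZ-\nabla_{[X,Y]}Z$ and $R(X,Y,Z,U)=g(R(X,Y)Z,U)$. For a basis $\{e_i\}$ of $T_pM$ let $(g^{ij})$ be the inverse of the matrix $(g(e_i,e_j))$, and put (summing over repeated indices) $$\|\nabla J\|^2=g^{ij}g^{kl}\,g\bigl((\nabla_{e_i}J)e_k,(\nabla_{e_j}J)e_l\bigr),\qquad \rho(y,z)=g^{ij}R(e_i,y,z,e_j),$$ $$\tau=g^{kl}\rho(e_k,e_l),\qquad \tau^{**}=g^{ij}g^{kl}R(e_i,e_k,Je_l,Je_j).$$ Suppose that $(M,J,g)$ is a $\mathcal W_3$-manifold (quasi-Kähler), i.e. $F(X,Y,Z)+F(Y,Z,X)+F(Z,X,Y)=0$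 for all $X,Y,Z$, and that it is isotropic Kähler, i.e. $\|\nabla J\|^2=0$ at every point of $M$. Then $$\tau^{**}=-\tau$$ at every point of $M$. -/

import Mathlib

open scoped Manifold ContDiff

noncomputable section

namespace Norden

/-- The model space `ℝ²ⁿ`. -/
abbrev Model (n : ℕ) : Type := EuclideanSpace ℝ (Fin (2 * n))

/-- The coordinate vector `e_i` of `ℝ²ⁿ`. -/
def vec {n : ℕ} (i : Fin (2 * n)) : Model n := EuclideanSpace.basisFun (Fin (2 * n)) ℝ i

/-- An almost complex structure `J` together with a Norden metric `g` on a smooth manifold `M` of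
dimension `2n`: smooth tensor fields of types `(1,1)` and `(0,2)` with `J² = -id`, `g` symmetric and
nondegenerate, and `g(Jv, Jw) = -g(v, w)`. -/
structure AlmostComplexNorden (n : ℕ) (M : Type*) [TopologicalSpace M]
    [ChartedSpace (Model n) M] [IsManifold 𝓘(ℝ, Model n) ∞ M] where
  J (p : M) : TangentSpace 𝓘(ℝ, Model n) p →L[ℝ] TangentSpace 𝓘(ℝ, Model n) p
  g (p : M) : TangentSpace 𝓘(ℝ, Model n) p →L[ℝ] TangentSpace 𝓘(ℝ, Model n) p →L[ℝ] ℝ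
  contMDiff_J : ContMDiff 𝓘(ℝ, Model n) (𝓘(ℝ, Model n).prod 𝓘(ℝ, Model n →L[ℝ] Model n)) ∞
    (fun p ↦ Bundle.TotalSpace.mk' (Model n →L[ℝ] Model n)
      (E := fun p : M ↦ TangentSpace 𝓘(ℝ, Model n) p →L[ℝ] TangentSpace 𝓘(ℝ, Model n) p) p (J p))
  contMDiff_g : ContMDiff 𝓘(ℝ, Model n) (𝓘(ℝ, Model n).prod 𝓘(ℝ, Model n →L[ℝ] Model n →L[ℝ] ℝ)) ∞
    (fun p ↦ Bundle.TotalSpace.mk' (Model n →L[ℝ] Model n →L[ℝ] ℝ)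
      (E := fun p : M ↦
        TangentSpace 𝓘(ℝ, Model n) p →L[ℝ] TangentSpace 𝓘(ℝ, Model n) p →L[ℝ] ℝ) p (g p))
  J_sq (p : M) (v : TangentSpace 𝓘(ℝ, Model n) p) : J p (J p v) = -v
  symm (p : M) (v w : TangentSpace 𝓘(ℝ, Model n) p) : g p v w = g p w v
  nondegenerate (p : M) (v : TangentSpace 𝓘(ℝ, Model n) p) : (∀ w, g p v w = 0) → v = 0
  norden (p : M) (v w : TangentSpace 𝓘(ℝ, Model n) p) : g p (J p v) (J p w) = -g p v w

namespace AlmostComplexNorden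

variable {n : ℕ} {M : Type*} [TopologicalSpace M] [ChartedSpace (Model n) M]
  [IsManifold 𝓘(ℝ, Model n) ∞ M] (S : AlmostComplexNorden n M)

/-! In what follows `e` is a chart of `M` and `x` a point of its image in `ℝ²ⁿ`. All tensors are
written in the chart `e`, i.e. after the identification of `T_p M`, `p = e⁻¹(x)`, with `ℝ²ⁿ` through
the differential of `e`; vectors of `ℝ²ⁿ` are then also the vector fields with constant components
in the chart. -/

/-- The coordinate frame: the vector of `T_p M`, `p = e⁻¹(x)`, with components `v` in the chart. -/
def ofChart (e : OpenPartialHomeomorph M (Model n)) (x v : Model n) :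
    TangentSpace 𝓘(ℝ, Model n) (e.symm x) :=
  mfderiv 𝓘(ℝ, Model n) 𝓘(ℝ, Model n) e.symm x v

/-- The components in the chart `e` of a vector `w` of `T_p M`, `p = e⁻¹(x)`. -/
def toChart (e : OpenPartialHomeomorph M (Model n)) (x : Model n)
    (w : TangentSpace 𝓘(ℝ, Model n) (e.symm x)) : Model n :=
  mfderiv 𝓘(ℝ, Model n) 𝓘(ℝ, Model n) e (e.symm x) w

/-- The metric `g` in the chart `e`. -/
def metric (e : OpenPartialHomeomorph M (Model n)) (x u v : Model n) : ℝ :=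
  S.g (e.symm x) (ofChart e x u) (ofChart e x v)

/-- The almost complex structure `J` in the chart `e`. -/
def cplx (e : OpenPartialHomeomorph M (Model n)) (x v : Model n) : Model n :=
  toChart e x (S.J (e.symm x) (ofChart e x v))

/-- The components `g^{ij}` of the inverse of the matrix `(g(e_i, e_j))`. -/
def invMetric (e : OpenPartialHomeomorph M (Model n)) (x : Model n) (i j : Fin (2 * n)) : ℝ :=
  (Matrix.of fun k l ↦ S.metric e x (vec k) (vec l))⁻¹ i j

/-- The Christoffel symbols of the Levi-Civita connection of `g`, as the vector
`Γ(u, v) = ∇_u v` for constant `u`, `v`: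
`g(Γ(u, v), w) = ½ (∂_u g(v, w) + ∂_v g(u, w) - ∂_w g(u, v))`. -/
def christoffel (e : OpenPartialHomeomorph M (Model n)) (x u v : Model n) : Model n :=
  ∑ k, ∑ l, ((1 / 2 : ℝ) * S.invMetric e x k l *
    (fderiv ℝ (fun y ↦ S.metric e y v (vec l)) x u
      + fderiv ℝ (fun y ↦ S.metric e y u (vec l)) x v
      - fderiv ℝ (fun y ↦ S.metric e y u v) x (vec l))) • vec k

/-- `(∇_u J) v = ∇_u (J v) - J (∇_u v)` (for constant `u`, `v`). -/
def nablaJ (e : OpenPartialHomeomorph M (Model n)) (x u v : Model n) : Model n :=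
  fderiv ℝ (fun y ↦ S.cplx e y v) x u + S.christoffel e x u (S.cplx e x v)
    - S.cplx e x (S.christoffel e x u v)

/-- The tensor `F(u, v, w) = g((∇_u J) v, w)`. -/
def F (e : OpenPartialHomeomorph M (Model n)) (x u v w : Model n) : ℝ :=
  S.metric e x (S.nablaJ e x u v) w

/-- The curvature `R(u, v) w = ∇_u ∇_v w - ∇_v ∇_u w - ∇_{[u, v]} w` (for constant `u`, `v`, `w`,
so that `[u, v] = 0`). -/
def curvature (e : OpenPartialHomeomorph M (Model n)) (x u v w : Model n) : Model n :=
  (fderiv ℝ (fun y ↦ S.christoffel e y v w) x u + S.christoffel e x u (S.christoffel e x v w))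
    - (fderiv ℝ (fun y ↦ S.christoffel e y u w) x v + S.christoffel e x v (S.christoffel e x u w))

/-- The curvature tensor of type `(0,4)`: `R(u, v, w, z) = g(R(u, v) w, z)`. -/
def curvature₄ (e : OpenPartialHomeomorph M (Model n)) (x u v w z : Model n) : ℝ :=
  S.metric e x (S.curvature e x u v w) z

/-- The Ricci tensor `ρ(v, w) = g^{ij} R(e_i, v, w, e_j)`. -/
def ricci (e : OpenPartialHomeomorph M (Model n)) (x v w : Model n) : ℝ :=
  ∑ i, ∑ j, S.invMetric e x i j * S.curvature₄ e x (vec i) v w (vec j)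

/-- The scalar curvature `τ = g^{kl} ρ(e_k, e_l)`. -/
def tau (e : OpenPartialHomeomorph M (Model n)) (x : Model n) : ℝ :=
  ∑ k, ∑ l, S.invMetric e x k l * S.ricci e x (vec k) (vec l)

/-- `τ** = g^{ij} g^{kl} R(e_i, e_k, J e_l, J e_j)`. -/
def tauStarStar (e : OpenPartialHomeomorph M (Model n)) (x : Model n) : ℝ :=
  ∑ i, ∑ j, ∑ k, ∑ l, S.invMetric e x i j * S.invMetric e x k l *
    S.curvature₄ e x (vec i) (vec k) (S.cplx e x (vec l)) (S.cplx e x (vec j))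

/-- The square norm `‖∇J‖ = g^{ij} g^{kl} g((∇_{e_i} J) e_k, (∇_{e_j} J) e_l)`. -/
def sqNormNablaJ (e : OpenPartialHomeomorph M (Model n)) (x : Model n) : ℝ :=
  ∑ i, ∑ j, ∑ k, ∑ l, S.invMetric e x i j * S.invMetric e x k l *
    S.metric e x (S.nablaJ e x (vec i) (vec k)) (S.nablaJ e x (vec j) (vec l))

/-- `(M, J, g)` is a quasi-Kähler manifold with Norden metric (a `𝒲₃`-manifold): the cyclic sum of
`F(u, v, w)` vanishes at every point, in every smooth chart. -/
def IsW3 : Prop :=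
  ∀ e ∈ IsManifold.maximalAtlas 𝓘(ℝ, Model n) ∞ M, ∀ p ∈ e.source, ∀ u v w : Model n,
    S.F e (e p) u v w + S.F e (e p) v w u + S.F e (e p) w u v = 0

/-- `(M, J, g)` is isotropic Kähler: `‖∇J‖ = 0` at every point, in every smooth chart. -/
def IsIsotropicKahler : Prop :=
  ∀ e ∈ IsManifold.maximalAtlas 𝓘(ℝ, Model n) ∞ M, ∀ p ∈ e.source, S.sqNormNablaJ e (e p) = 0

end AlmostComplexNorden

end Norden

end

/-! In fact `‖∇J‖² = -2 (τ + τ**)` on every quasi-Kähler manifold with Norden metric, so the theorem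
is immediate once `‖∇J‖² = 0`. The link is the Ricci identity `∇²_{u,v} J - ∇²_{v,u} J = [R(u,v),
J]` (`nabla2J_sub_nabla2J`). Composed with `J` and contracted twice with the metric, its right side
becomes `τ + τ**`. On the left, one contraction vanishes: `∇_u J` is trace-free, so the cyclic
condition kills the Lee form, and hence also its covariant derivative. In the other contraction,
moving `J` past `∇²J` leaves only terms quadratic in `∇J`, and a single one survives, the scalar
`crossTerm`. Thus `τ + τ** = crossTerm` (`sum_curv_add`). Applying the cyclic condition to one
factor of `‖∇J‖²` gives `-2 crossTerm` (`sqNorm_nablaJ`). The argument is local: it is carried out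
for operator fields on an open set of a vector space and transferred to charts by `toLocal`. -/

noncomputable section

namespace Norden

set_option linter.unusedSectionVars false

/-! ### Covariant derivatives of `J` and the Ricci identity on an open set -/

section Calculus

variable {E : Type*} [NormedAddCommGroup E] [NormedSpace ℝ E] [FiniteDimensional ℝ E]

/-- An almost complex structure with Norden metric on an open subset of a vector space, with a
torsion-free metric connection `∂ + Γ`. -/
structure LocalNorden (U : Set E) where
  g : E → E →L[ℝ] E →L[ℝ] ℝ
  J : E → E →L[ℝ] E
  Γ : E → E →L[ℝ] E →L[ℝ] E
  isOpen : IsOpen U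
  contDiffOn_g : ContDiffOn ℝ ∞ g U
  contDiffOn_J : ContDiffOn ℝ ∞ J U
  contDiffOn_Γ : ContDiffOn ℝ ∞ Γ U
  symm : ∀ x ∈ U, ∀ v w, g x v w = g x w v
  nondegenerate : ∀ x ∈ U, ∀ v, (∀ w, g x v w = 0) → v = 0
  J_sq : ∀ x ∈ U, J x * J x = -1
  selfAdjoint_J : ∀ x ∈ U, ∀ v w, g x (J x v) w = g x v (J x w)
  torsionFree : ∀ x ∈ U, ∀ u v, Γ x u v = Γ x v u
  compat : ∀ x ∈ U, ∀ u v w, fderiv ℝ g x u v w = g x (Γ x u v) w + g x v (Γ x u w)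

/-- The trace, as a continuous linear functional. -/
def traceL : (E →L[ℝ] E) →L[ℝ] ℝ :=
  ((LinearMap.trace ℝ E) ∘ₗ (ContinuousLinearMap.coeLM ℝ)).toContinuousLinearMap

theorem traceL_apply (T : E →L[ℝ] E) : traceL T = LinearMap.trace ℝ E (T : E →ₗ[ℝ] E) := rfl

theorem traceL_mul_comm (S T : E →L[ℝ] E) : traceL (S * T) = traceL (T * S) :=
  LinearMap.trace_mul_comm ℝ (S : E →ₗ[ℝ] E) (T : E →ₗ[ℝ] E)

theorem traceL_eq_sum {ι : Type*} [Fintype ι] (b : Module.Basis ι ℝ E) (T : E →L[ℝ] E) :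
    traceL T = ∑ i, b.repr (T (b i)) i := by
  classical
  rw [traceL_apply, LinearMap.trace_eq_matrix_trace ℝ b]
  simp [Matrix.trace, LinearMap.toMatrix_apply]

namespace LocalNorden

variable {U : Set E} (D : LocalNorden U) {x : E}

/-- The covariant derivative of `J`, i.e. `∇_u J = ∂_u J + [Γ_u, J]`. -/
def nablaJ (x : E) : E →L[ℝ] E →L[ℝ] E :=
  fderiv ℝ D.J x + ((ContinuousLinearMap.compL ℝ E E E).flip (D.J x)) ∘L D.Γ x
    - (ContinuousLinearMap.compL ℝ E E E (D.J x)) ∘L D.Γ x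

theorem nablaJ_apply (x u : E) :
    D.nablaJ x u = fderiv ℝ D.J x u + D.Γ x u * D.J x - D.J x * D.Γ x u := rfl

/-- The second covariant derivative `∇²_{u,v} J`. -/
def nabla2J (x u v : E) : E →L[ℝ] E :=
  fderiv ℝ D.nablaJ x u v + D.Γ x u * D.nablaJ x v - D.nablaJ x v * D.Γ x u
    - D.nablaJ x (D.Γ x u v)

/-- The curvature operator `R(u, v)`. -/
def curv (x u v : E) : E →L[ℝ] E :=
  fderiv ℝ D.Γ x u v - fderiv ℝ D.Γ x v u + D.Γ x u * D.Γ x v - D.Γ x v * D.Γ x u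

include D in
theorem mem_nhds (hx : x ∈ U) : U ∈ nhds x := D.isOpen.mem_nhds hx

theorem hasFDerivAt_g (hx : x ∈ U) : HasFDerivAt D.g (fderiv ℝ D.g x) x :=
  ((D.contDiffOn_g.contDiffAt (D.mem_nhds hx)).differentiableAt (by simp)).hasFDerivAt

theorem hasFDerivAt_J (hx : x ∈ U) : HasFDerivAt D.J (fderiv ℝ D.J x) x :=
  ((D.contDiffOn_J.contDiffAt (D.mem_nhds hx)).differentiableAt (by simp)).hasFDerivAt

theorem hasFDerivAt_Γ (hx : x ∈ U) : HasFDerivAt D.Γ (fderiv ℝ D.Γ x) x :=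
  ((D.contDiffOn_Γ.contDiffAt (D.mem_nhds hx)).differentiableAt (by simp)).hasFDerivAt

theorem hasFDerivAt_fderiv_J (hx : x ∈ U) :
    HasFDerivAt (fderiv ℝ D.J) (fderiv ℝ (fderiv ℝ D.J) x) x :=
  (((D.contDiffOn_J.contDiffAt (D.mem_nhds hx)).fderiv_right (m := 1)
    (by norm_cast)).differentiableAt (by simp)).hasFDerivAt

theorem fderiv_fderiv_J_symm (hx : x ∈ U) (u v : E) :
    fderiv ℝ (fderiv ℝ D.J) x u v = fderiv ℝ (fderiv ℝ D.J) x v u :=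
  (D.contDiffOn_J.contDiffAt (D.mem_nhds hx)).isSymmSndFDerivAt
    (by rw [minSmoothness_of_isRCLikeNormedField]; exact WithTop.coe_le_coe.2 le_top) u v

theorem differentiableAt_nablaJ (hx : x ∈ U) : DifferentiableAt ℝ D.nablaJ x := by
  have hJ := (D.hasFDerivAt_J hx).differentiableAt
  have hΓ := (D.hasFDerivAt_Γ hx).differentiableAt
  have hJ' := (D.hasFDerivAt_fderiv_J hx).differentiableAt
  have h₁ : DifferentiableAt ℝ
      (fun y ↦ ((ContinuousLinearMap.compL ℝ E E E).flip (D.J y)) ∘L D.Γ y) x :=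
    DifferentiableAt.clm_comp (by fun_prop) hΓ
  have h₂ : DifferentiableAt ℝ
      (fun y ↦ (ContinuousLinearMap.compL ℝ E E E (D.J y)) ∘L D.Γ y) x :=
    DifferentiableAt.clm_comp (by fun_prop) hΓ
  exact (hJ'.add h₁).sub h₂

/-- Evaluation of an operator-valued form at a vector commutes with derivatives. -/
theorem fderiv_apply_const {F G : Type*} [NormedAddCommGroup F] [NormedSpace ℝ F]
    [NormedAddCommGroup G] [NormedSpace ℝ G] {f : E → F →L[ℝ] G} (hf : DifferentiableAt ℝ f x)
    (v : F) (u : E) : fderiv ℝ (fun y ↦ f y v) x u = fderiv ℝ f x u v := by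
  rw [fderiv_clm_apply hf (by fun_prop)]; simp

theorem fderiv_mul_apply {A B : E → E →L[ℝ] E} (hA : DifferentiableAt ℝ A x)
    (hB : DifferentiableAt ℝ B x) (u : E) :
    fderiv ℝ (fun y ↦ A y * B y) x u = A x * fderiv ℝ B x u + fderiv ℝ A x u * B x := by
  have h := (hA.hasFDerivAt.mul' hB.hasFDerivAt).fderiv
  rw [show (fun y ↦ A y * B y) = A * B from rfl, h]
  simp

theorem fderiv_nablaJ_apply (hx : x ∈ U) (u v : E) :
    fderiv ℝ D.nablaJ x u v = fderiv ℝ (fderiv ℝ D.J) x u v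
      + (fderiv ℝ D.Γ x u v * D.J x + D.Γ x v * fderiv ℝ D.J x u)
      - (fderiv ℝ D.J x u * D.Γ x v + D.J x * fderiv ℝ D.Γ x u v) := by
  have hJ := (D.hasFDerivAt_J hx).differentiableAt
  have hΓ := (D.hasFDerivAt_Γ hx).differentiableAt
  have hJ' := (D.hasFDerivAt_fderiv_J hx).differentiableAt
  have hΓv : DifferentiableAt ℝ (fun y ↦ D.Γ y v) x := by fun_prop
  rw [← fderiv_apply_const (D.differentiableAt_nablaJ hx)]
  simp only [nablaJ_apply]
  rw [fderiv_fun_sub (by fun_prop) (by fun_prop), fderiv_fun_add (by fun_prop) (by fun_prop)]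
  simp only [sub_apply, add_apply]
  rw [fderiv_mul_apply hΓv hJ, fderiv_mul_apply hJ hΓv, fderiv_apply_const hJ',
    fderiv_apply_const hΓ]
  abel

/-- The Ricci identity for `J`. -/
theorem nabla2J_sub_nabla2J (hx : x ∈ U) (u v : E) :
    D.nabla2J x u v - D.nabla2J x v u = D.curv x u v * D.J x - D.J x * D.curv x u v := by
  -- Symmetry of `∂²J` and of `Γ` makes the pure second derivatives and the terms `∇_{Γ(u,v)} J`
  -- cancel; the rest is algebra in the ring of operators.
  rw [nabla2J, nabla2J, D.fderiv_nablaJ_apply hx, D.fderiv_nablaJ_apply hx,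
    D.fderiv_fderiv_J_symm hx v u, D.torsionFree x hx v u, D.nablaJ_apply x u, D.nablaJ_apply x v, curv]
  noncomm_ring

/-- The covariant derivative of a field of self-adjoint operators is self-adjoint. -/
theorem selfAdjoint_nabla {B : E → E →L[ℝ] E} (hx : x ∈ U) (hB : DifferentiableAt ℝ B x)
    (h : ∀ y ∈ U, ∀ v w, D.g y (B y v) w = D.g y v (B y w)) (u v w : E) :
    D.g x ((fderiv ℝ B x u + D.Γ x u * B x - B x * D.Γ x u) v) w
      = D.g x v ((fderiv ℝ B x u + D.Γ x u * B x - B x * D.Γ x u) w) := by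
  have hg := (D.hasFDerivAt_g hx).differentiableAt
  have key : fderiv ℝ (fun y ↦ D.g y (B y v) w) x u = fderiv ℝ (fun y ↦ D.g y v (B y w)) x u := by
    congr 1
    exact Filter.EventuallyEq.fderiv_eq
      (Filter.mem_of_superset (D.mem_nhds hx) fun y hy ↦ h y hy v w)
  have hBv : ∀ z, DifferentiableAt ℝ (fun y ↦ B y z) x := fun z ↦ by fun_prop
  rw [fderiv_apply_const (f := fun y ↦ D.g y (B y v)) (by fun_prop),
    fderiv_clm_apply hg (hBv v), fderiv_clm_apply (c := fun y ↦ D.g y v) (by fun_prop) (hBv w)] at key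
  simp only [add_apply, ContinuousLinearMap.comp_apply,
    ContinuousLinearMap.flip_apply, fderiv_apply_const hB, fderiv_apply_const hg,
    D.compat x hx] at key
  -- Metric compatibility turns the derivative of `g` into terms with `Γ_u`; these two instances
  -- move `B` across so that they assemble into `[Γ_u, B]`.
  have h1 := h x hx v (D.Γ x u w)
  have h2 := h x hx (D.Γ x u v) w
  simp only [add_apply, sub_apply,
    ContinuousLinearMap.mul_def, ContinuousLinearMap.comp_apply, map_add, map_sub]
  linarith

theorem selfAdjoint_nablaJ (hx : x ∈ U) (u v w : E) :
    D.g x (D.nablaJ x u v) w = D.g x v (D.nablaJ x u w) := by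
  simp only [nablaJ_apply]
  exact D.selfAdjoint_nabla hx (D.hasFDerivAt_J hx).differentiableAt D.selfAdjoint_J u v w

theorem selfAdjoint_nabla2J (hx : x ∈ U) (u v w z : E) :
    D.g x (D.nabla2J x u v w) z = D.g x w (D.nabla2J x u v z) := by
  have hA := D.differentiableAt_nablaJ hx
  have h := D.selfAdjoint_nabla hx (B := fun y ↦ D.nablaJ y v) (by fun_prop)
    (fun y hy ↦ D.selfAdjoint_nablaJ hy v) u w z
  have h' := D.selfAdjoint_nablaJ hx (D.Γ x u v) w z
  rw [fderiv_apply_const hA] at h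
  rw [nabla2J]
  generalize fderiv ℝ D.nablaJ x u v + D.Γ x u * D.nablaJ x v - D.nablaJ x v * D.Γ x u = T at h ⊢
  simp only [sub_apply, map_sub, h, h']

/-- Covariant derivative of `J² = -1`: the connection contributes `[Γ_u, J²]`, which is zero. -/
theorem J_anticomm_nablaJ (hx : x ∈ U) (u : E) :
    D.J x * D.nablaJ x u = -(D.nablaJ x u * D.J x) := by
  have hJ := (D.hasFDerivAt_J hx).differentiableAt
  have h : fderiv ℝ (fun y ↦ D.J y * D.J y) x u = 0 := by
    have : (fun y ↦ D.J y * D.J y) =ᶠ[nhds x] fun _ ↦ -1 :=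
      Filter.mem_of_superset (D.mem_nhds hx) D.J_sq
    rw [this.fderiv_eq]; simp
  rw [fderiv_mul_apply hJ hJ] at h
  have h2 := D.J_sq x hx
  rw [nablaJ_apply, eq_neg_iff_add_eq_zero]
  calc _ = (D.J x * fderiv ℝ D.J x u + fderiv ℝ D.J x u * D.J x)
        + D.Γ x u * (D.J x * D.J x) - (D.J x * D.J x) * D.Γ x u := by noncomm_ring
    _ = 0 := by rw [h, h2]; simp

/-- The covariant derivative of the identity `J (∇_v J) = - (∇_v J) J`. -/
theorem J_mul_nabla2J (hx : x ∈ U) (u v : E) :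
    D.J x * D.nabla2J x u v = -(D.nabla2J x u v * D.J x)
      - D.nablaJ x u * D.nablaJ x v - D.nablaJ x v * D.nablaJ x u := by
  have hJ := (D.hasFDerivAt_J hx).differentiableAt
  have hA := D.differentiableAt_nablaJ hx
  have hAv : DifferentiableAt ℝ (fun y ↦ D.nablaJ y v) x := by fun_prop
  have h : fderiv ℝ (fun y ↦ D.J y * D.nablaJ y v) x u
      = -fderiv ℝ (fun y ↦ D.nablaJ y v * D.J y) x u := by
    have : (fun y ↦ D.J y * D.nablaJ y v) =ᶠ[nhds x] fun y ↦ -(D.nablaJ y v * D.J y) :=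
      Filter.mem_of_superset (D.mem_nhds hx) fun y hy ↦ D.J_anticomm_nablaJ hy v
    rw [this.fderiv_eq, fderiv_fun_neg]; simp
  rw [fderiv_mul_apply hJ hAv, fderiv_mul_apply hAv hJ, fderiv_apply_const hA] at h
  have hd : fderiv ℝ D.J x u = D.nablaJ x u - D.Γ x u * D.J x + D.J x * D.Γ x u := by
    rw [nablaJ_apply]; abel
  have hv := D.J_anticomm_nablaJ hx v
  have hΓ := D.J_anticomm_nablaJ hx (D.Γ x u v)
  rw [hd] at h
  rw [← sub_eq_zero] at h hv hΓ ⊢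
  rw [nabla2J]
  -- With `C_v = J ∇_v J + (∇_v J) J = 0`, this is the covariant derivative `∂_u C_v + [Γ_u, C_v] -
  -- C_{Γ(u,v)}`.
  linear_combination (norm := noncomm_ring) h + D.Γ x u * hv - hv * D.Γ x u - hΓ

/-- An operator `T` anticommuting with `J` satisfies `T = J T J`, so cyclicity of the trace gives
`tr T = tr (T J²) = -tr T`. -/
theorem traceL_nablaJ (hx : x ∈ U) (u : E) : traceL (D.nablaJ x u) = 0 := by
  have h : D.nablaJ x u = D.J x * (D.nablaJ x u * D.J x) := by
    have := congrArg (· * D.J x) (D.J_anticomm_nablaJ hx u)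
    simp only [mul_assoc, neg_mul, D.J_sq x hx] at this
    rw [this]; simp
  have h' := traceL_mul_comm (D.J x) (D.nablaJ x u * D.J x)
  rw [← h, mul_assoc, D.J_sq x hx, mul_neg, mul_one, map_neg] at h'
  linarith

/-- The cyclic condition that characterizes quasi-Kähler manifolds with Norden metric. -/
def Cyclic : Prop := ∀ x ∈ U, ∀ u v w,
  D.g x (D.nablaJ x u v) w + D.g x (D.nablaJ x v w) u + D.g x (D.nablaJ x w u) v = 0

end LocalNorden
end Calculus

/-! ### Metric contractions as traces, and the two scalar identities -/

section Trace
variable {E : Type*} [NormedAddCommGroup E] [NormedSpace ℝ E] [FiniteDimensional ℝ E]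
  {ι : Type*} [Fintype ι]

theorem sum_comm_pairs (f : ι → ι → ι → ι → ℝ) :
    ∑ i, ∑ j, ∑ k, ∑ l, f i j k l = ∑ k, ∑ l, ∑ i, ∑ j, f i j k l := by
  have h := Finset.sum_comm (s := Finset.univ) (t := Finset.univ)
    (f := fun p q : ι × ι ↦ f p.1 p.2 q.1 q.2)
  simpa only [← Finset.univ_product_univ, Finset.sum_product] using h

/-- `gi` is the inverse matrix of the Gram matrix of the bilinear form `B` in the basis `b`. -/
structure IsInverseGram (b : Module.Basis ι ℝ E) (B : E →L[ℝ] E →L[ℝ] ℝ) (gi : ι → ι → ℝ) :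
    Prop where
  symm : ∀ i j, gi i j = gi j i
  repr : ∀ v i, b.repr v i = ∑ j, gi i j * B v (b j)

namespace IsInverseGram

variable {b : Module.Basis ι ℝ E} {B : E →L[ℝ] E →L[ℝ] ℝ} {gi : ι → ι → ℝ}

/-- Contracting with the inverse metric is a basis-free trace, which makes cyclicity available for
index sums. -/
theorem sum_eq_traceL (h : IsInverseGram b B gi) (T : E →L[ℝ] E) :
    ∑ i, ∑ j, gi i j * B (T (b i)) (b j) = traceL T := by
  simp only [traceL_eq_sum b, h.repr]

theorem sum_sum_smul (h : IsInverseGram b B gi) (v : E) :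
    ∑ k, ∑ l, (gi k l * B v (b k)) • b l = v := by
  rw [Finset.sum_comm]
  simp only [← Finset.sum_smul]
  conv_rhs => rw [← b.sum_repr v]
  refine Finset.sum_congr rfl fun l _ ↦ ?_
  rw [h.repr]
  simp only [h.symm l]

/-- Raising the index of a linear form. -/
theorem apply_sum_smul (h : IsInverseGram b B gi) (hB : ∀ v w, B v w = B w v) (φ : E →L[ℝ] ℝ)
    (w : E) : B (∑ k, ∑ l, (gi k l * φ (b l)) • b k) w = φ w := by
  conv_rhs => rw [← h.sum_sum_smul w]
  simp only [map_sum, map_smul, FunLike.coe_sum, FunLike.coe_smul, Finset.sum_apply,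
    Pi.smul_apply, smul_eq_mul, hB w]
  exact Finset.sum_congr rfl fun k _ ↦ Finset.sum_congr rfl fun l _ ↦ by ring

end IsInverseGram

namespace LocalNorden

variable {U : Set E} (D : LocalNorden U) {x : E}

/-- The Lee form `θ(w)`, the trace of `u ↦ (∇_u J) w`, vanishes. -/
theorem Cyclic.traceL_flip_nablaJ {D : LocalNorden U} {b : Module.Basis ι ℝ E} {gi : ι → ι → ℝ}
    (hD : D.Cyclic) (hx : x ∈ U) (hgi : IsInverseGram b (D.g x) gi) (w : E) :
    traceL ((D.nablaJ x).flip w) = 0 := by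
  have h₀ := hgi.sum_eq_traceL ((D.nablaJ x).flip w)
  have h₁ := hgi.sum_eq_traceL (D.nablaJ x w)
  rw [D.traceL_nablaJ hx] at h₁
  have h₂ : ∑ i, ∑ j, gi i j * D.g x ((D.nablaJ x).flip w (b j)) (b i)
      = traceL ((D.nablaJ x).flip w) := by
    rw [← h₀, Finset.sum_comm]
    simp only [hgi.symm]
  -- The contracted cyclic identity reads `2 θ(w) + tr (∇_w J) = 0`.
  have h : ∑ i, ∑ j, gi i j * D.g x ((D.nablaJ x).flip w (b i)) (b j)
      + ∑ i, ∑ j, gi i j * D.g x ((D.nablaJ x).flip w (b j)) (b i)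
      + ∑ i, ∑ j, gi i j * D.g x (D.nablaJ x w (b i)) (b j) = 0 := by
    simp only [← Finset.sum_add_distrib]
    refine Finset.sum_eq_zero fun i _ ↦ Finset.sum_eq_zero fun j _ ↦ ?_
    have hc := hD x hx (b i) w (b j)
    rw [D.selfAdjoint_nablaJ hx w (b j), D.symm x hx _ (D.nablaJ x w (b i)),
      D.selfAdjoint_nablaJ hx (b j) (b i) w, D.symm x hx (b i)] at hc
    simp only [ContinuousLinearMap.flip_apply]
    linear_combination gi i j * hc
  linarith

/-- The second covariant derivative of `J` as a linear map in the second direction. -/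
def nabla2JL (x u : E) : E →L[ℝ] E →L[ℝ] E :=
  fderiv ℝ D.nablaJ x u + (ContinuousLinearMap.compL ℝ E E E (D.Γ x u)) ∘L D.nablaJ x
    - ((ContinuousLinearMap.compL ℝ E E E).flip (D.Γ x u)) ∘L D.nablaJ x - D.nablaJ x ∘L D.Γ x u

theorem nabla2JL_apply (x u v : E) : D.nabla2JL x u v = D.nabla2J x u v := rfl

/-- The covariant derivative of the vanishing Lee form vanishes. -/
theorem traceL_flip_nabla2JL (hθ : ∀ y ∈ U, ∀ w, traceL ((D.nablaJ y).flip w) = 0) (hx : x ∈ U)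
    (u w : E) : traceL ((D.nabla2JL x u).flip w) = 0 := by
  have hA := D.differentiableAt_nablaJ hx
  have h : traceL ((fderiv ℝ D.nablaJ x u).flip w) = 0 := by
    -- `θ(w)` is a fixed linear functional of `∇J`, hence commutes with differentiation.
    let L : (E →L[ℝ] E →L[ℝ] E) →L[ℝ] ℝ := traceL ∘L
      (ContinuousLinearMap.apply ℝ (E →L[ℝ] E) w) ∘L
        (ContinuousLinearMap.flipₗᵢ ℝ E E E : (E →L[ℝ] E →L[ℝ] E) →L[ℝ] (E →L[ℝ] E →L[ℝ] E))
    have hL : (fun y ↦ L (D.nablaJ y)) =ᶠ[nhds x] fun _ ↦ 0 :=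
      Filter.mem_of_superset (D.mem_nhds hx) fun y hy ↦ hθ y hy w
    have h' := hL.fderiv_eq (𝕜 := ℝ)
    have h'' : fderiv ℝ (fun y ↦ L (D.nablaJ y)) x = _ := (L.hasFDerivAt.comp x hA.hasFDerivAt).fderiv
    rw [h''] at h'
    have := congrArg (fun T : E →L[ℝ] ℝ ↦ T u) h'
    simpa [L] using this
  have hd : (D.nabla2JL x u).flip w = (fderiv ℝ D.nablaJ x u).flip w
      + D.Γ x u * (D.nablaJ x).flip w - (D.nablaJ x).flip (D.Γ x u w)
      - (D.nablaJ x).flip w * D.Γ x u := rfl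
  rw [hd, map_sub, map_sub, map_add, h, hθ x hx, traceL_mul_comm]
  ring

/-- The metric contraction of `∇²J` in its last two arguments vanishes. -/
theorem sum_nabla2J {b : Module.Basis ι ℝ E} {gi : ι → ι → ℝ}
    (hθ : ∀ y ∈ U, ∀ w, traceL ((D.nablaJ y).flip w) = 0) (hx : x ∈ U)
    (hgi : IsInverseGram b (D.g x) gi) (u : E) :
    ∑ k, ∑ l, gi k l • D.nabla2J x u (b k) (b l) = 0 := by
  -- Pairing with `w` and moving the self-adjoint `∇²J` onto `w` turns the contraction into the
  -- derivative of the Lee form.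
  refine D.nondegenerate x hx _ fun w ↦ ?_
  rw [← D.traceL_flip_nabla2JL hθ hx u w, ← hgi.sum_eq_traceL]
  simp only [map_sum, map_smul, FunLike.coe_sum, FunLike.coe_smul, Finset.sum_apply, Pi.smul_apply,
    smul_eq_mul, ContinuousLinearMap.flip_apply, nabla2JL_apply, D.selfAdjoint_nabla2J hx,
    D.symm x hx (b _)]

/-- The scalar `∑ g^{kl} tr(u ↦ (∇_{e_k} J) (∇_u J) e_l)`. -/
def crossTerm (b : Module.Basis ι ℝ E) (gi : ι → ι → ℝ) (x : E) : ℝ :=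
  ∑ k, ∑ l, gi k l * traceL (D.nablaJ x (b k) * (D.nablaJ x).flip (b l))

/-- When `J` is moved past `∇²J`, two of the three resulting traces vanish: the derivative of the
Lee form at `J w`, and the Lee form at `(∇_u J) w`. -/
theorem traceL_J_mul_nabla2JL (hθ : ∀ y ∈ U, ∀ w, traceL ((D.nablaJ y).flip w) = 0) (hx : x ∈ U)
    (u w : E) : traceL (D.J x * (D.nabla2JL x u).flip w)
      = -traceL (D.nablaJ x u * (D.nablaJ x).flip w) := by
  have h : D.J x * (D.nabla2JL x u).flip w = -(D.nabla2JL x u).flip (D.J x w)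
      - D.nablaJ x u * (D.nablaJ x).flip w - (D.nablaJ x).flip (D.nablaJ x u w) := by
    ext v
    exact congrArg (fun T : E →L[ℝ] E ↦ T w) (D.J_mul_nabla2J hx u v)
  rw [h, map_sub, map_sub, map_neg, D.traceL_flip_nabla2JL hθ hx, hθ x hx]
  ring

/-- The sum `τ + τ**` in terms of the first covariant derivative of `J`. -/
theorem sum_curv_add {b : Module.Basis ι ℝ E} {gi : ι → ι → ℝ}
    (hθ : ∀ y ∈ U, ∀ w, traceL ((D.nablaJ y).flip w) = 0) (hx : x ∈ U)
    (hgi : IsInverseGram b (D.g x) gi) :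
    ∑ i, ∑ j, ∑ k, ∑ l, gi i j * gi k l *
      (D.g x (D.curv x (b i) (b k) (b l)) (b j)
        + D.g x (D.curv x (b i) (b k) (D.J x (b l))) (D.J x (b j))) = D.crossTerm b gi x := by
  -- Since `J² = -1`, composing the Ricci identity with `J` gives `J [R, J] = R + J R J`;
  -- self-adjointness then shifts the outer `J` to `z`.
  have hop : ∀ u v w z, D.g x (D.curv x u v w) z + D.g x (D.curv x u v (D.J x w)) (D.J x z)
      = D.g x (D.J x (D.nabla2J x u v w)) z - D.g x (D.J x (D.nabla2J x v u w)) z := by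
    intro u v w z
    have h := congrArg (fun T : E →L[ℝ] E ↦ D.g x (D.J x (T w)) z) (D.nabla2J_sub_nabla2J hx u v)
    have hJ : ∀ y, D.J x (D.J x y) = -y := fun y ↦
      congrArg (fun T : E →L[ℝ] E ↦ T y) (D.J_sq x hx)
    simp only [sub_apply, ContinuousLinearMap.mul_def, ContinuousLinearMap.comp_apply, map_sub, hJ,
      map_neg, neg_apply] at h
    rw [h, ← D.selfAdjoint_J x hx]
    ring
  have h₁ : ∑ i, ∑ j, ∑ k, ∑ l, gi i j * gi k l *
      D.g x (D.J x (D.nabla2J x (b i) (b k) (b l))) (b j) = 0 := by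
    refine Finset.sum_eq_zero fun i _ ↦ Finset.sum_eq_zero fun j _ ↦ ?_
    have h := congrArg (fun v ↦ gi i j * D.g x (D.J x v) (b j)) (D.sum_nabla2J hθ hx hgi (b i))
    simpa only [map_sum, map_smul, FunLike.coe_sum, FunLike.coe_smul, Finset.sum_apply,
      Pi.smul_apply, smul_eq_mul, map_zero, zero_apply, mul_zero, Finset.mul_sum,
      ← mul_assoc] using h
  have h₂ : ∑ i, ∑ j, ∑ k, ∑ l, gi i j * gi k l *
      D.g x (D.J x (D.nabla2J x (b k) (b i) (b l))) (b j) = -D.crossTerm b gi x := by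
    have hc : -D.crossTerm b gi x
        = ∑ k, ∑ l, gi k l * traceL (D.J x * (D.nabla2JL x (b k)).flip (b l)) := by
      simp only [crossTerm, ← Finset.sum_neg_distrib, ← mul_neg, D.traceL_J_mul_nabla2JL hθ hx]
    rw [hc]
    simp only [← hgi.sum_eq_traceL, Finset.mul_sum]
    rw [sum_comm_pairs]
    refine Finset.sum_congr rfl fun k _ ↦ Finset.sum_congr rfl fun l _ ↦
      Finset.sum_congr rfl fun i _ ↦ Finset.sum_congr rfl fun j _ ↦ ?_
    rw [← mul_assoc, mul_comm (gi k l)]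
    rfl
  simp only [hop, mul_sub, Finset.sum_sub_distrib, h₁, h₂]
  ring

/-- The square norm of `∇J` on a quasi-Kähler manifold with Norden metric. -/
theorem sqNorm_nablaJ {b : Module.Basis ι ℝ E} {gi : ι → ι → ℝ} (hD : D.Cyclic) (hx : x ∈ U)
    (hgi : IsInverseGram b (D.g x) gi) :
    ∑ i, ∑ j, ∑ k, ∑ l, gi i j * gi k l *
      D.g x (D.nablaJ x (b i) (b k)) (D.nablaJ x (b j) (b l)) = -2 * D.crossTerm b gi x := by
  -- The cyclic condition is used with third argument `(∇_{e_j} J) e_l`; each of the two resulting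
  -- terms contracts to `crossTerm`.
  have hc : ∀ i j k l, D.g x (D.nablaJ x (b i) (b k)) (D.nablaJ x (b j) (b l))
      = -D.g x (D.nablaJ x (b k) (D.nablaJ x (b j) (b l))) (b i)
        - D.g x (D.nablaJ x (D.nablaJ x (b j) (b l)) (b i)) (b k) := fun i j k l ↦ by
    linarith [hD x hx (b i) (b k) (D.nablaJ x (b j) (b l))]
  have h₁ : ∑ i, ∑ j, ∑ k, ∑ l, gi i j * gi k l *
      D.g x (D.nablaJ x (b k) (D.nablaJ x (b j) (b l))) (b i) = D.crossTerm b gi x := by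
    rw [sum_comm_pairs]
    simp only [crossTerm, ← hgi.sum_eq_traceL, Finset.mul_sum]
    refine Finset.sum_congr rfl fun k _ ↦ Finset.sum_congr rfl fun l _ ↦ ?_
    rw [Finset.sum_comm]
    refine Finset.sum_congr rfl fun j _ ↦ Finset.sum_congr rfl fun i _ ↦ ?_
    rw [← mul_assoc, mul_comm (gi k l), hgi.symm i j]
    rfl
  have h₂ : ∑ i, ∑ j, ∑ k, ∑ l, gi i j * gi k l *
      D.g x (D.nablaJ x (D.nablaJ x (b j) (b l)) (b i)) (b k) = D.crossTerm b gi x := by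
    rw [Finset.sum_comm]
    simp only [crossTerm]
    refine Finset.sum_congr rfl fun j _ ↦ Finset.sum_congr rfl fun i _ ↦ ?_
    -- Here the two factors occur in the opposite order, so cyclicity of the trace is needed.
    rw [traceL_mul_comm, ← hgi.sum_eq_traceL, Finset.sum_comm, Finset.mul_sum]
    refine Finset.sum_congr rfl fun l _ ↦ ?_
    rw [Finset.mul_sum]
    refine Finset.sum_congr rfl fun k _ ↦ ?_
    rw [hgi.symm i j, hgi.symm k l, mul_assoc]
    rfl
  simp only [hc, mul_sub, mul_neg, Finset.sum_sub_distrib, Finset.sum_neg_distrib, h₁, h₂]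
  ring

end LocalNorden
end Trace

/-! ### Smoothness of `g` and `J` in a chart -/

namespace AlmostComplexNorden

variable {n : ℕ} {M : Type*} [TopologicalSpace M] [ChartedSpace (Model n) M]
  [IsManifold 𝓘(ℝ, Model n) ∞ M] (S : AlmostComplexNorden n M)
  {e : OpenPartialHomeomorph M (Model n)}

theorem mdifferentiable_chart (he : e ∈ IsManifold.maximalAtlas 𝓘(ℝ, Model n) ∞ M) :
    e.MDifferentiable 𝓘(ℝ, Model n) 𝓘(ℝ, Model n) :=
  ⟨(contMDiffOn_of_mem_maximalAtlas he).mdifferentiableOn (by simp),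
    (contMDiffOn_symm_of_mem_maximalAtlas he).mdifferentiableOn (by simp)⟩

theorem toChart_ofChart (he : e ∈ IsManifold.maximalAtlas 𝓘(ℝ, Model n) ∞ M) {x : Model n}
    (hx : x ∈ e.target) (v : Model n) : toChart e x (ofChart e x v) = v :=
  congrArg (fun T : Model n →L[ℝ] Model n ↦ T v) ((mdifferentiable_chart he).comp_symm_deriv hx)

theorem ofChart_toChart (he : e ∈ IsManifold.maximalAtlas 𝓘(ℝ, Model n) ∞ M) {x : Model n}
    (hx : x ∈ e.target) (w : TangentSpace 𝓘(ℝ, Model n) (e.symm x)) :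
    ofChart e x (toChart e x w) = w := by
  have h := (mdifferentiable_chart he).symm_comp_deriv (e.map_target hx)
  rw [e.right_inv hx] at h
  exact congrArg (fun T : Model n →L[ℝ] Model n ↦ T w) h

/-- The metric in the chart `e`, as a field of continuous bilinear forms. -/
def metricL (e : OpenPartialHomeomorph M (Model n)) (x : Model n) :
    Model n →L[ℝ] Model n →L[ℝ] ℝ :=
  ContinuousLinearMap.bilinearComp (E := Model n) (F := Model n) (S.g (e.symm x))
    (mfderiv 𝓘(ℝ, Model n) 𝓘(ℝ, Model n) e.symm x) (mfderiv 𝓘(ℝ, Model n) 𝓘(ℝ, Model n) e.symm x)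

theorem metricL_apply (x u v : Model n) : S.metricL e x u v = S.metric e x u v := rfl

/-- The almost complex structure in the chart `e`, as a field of continuous linear maps. -/
def cplxL (e : OpenPartialHomeomorph M (Model n)) (x : Model n) : Model n →L[ℝ] Model n :=
  ContinuousLinearMap.comp (M₁ := Model n) (M₂ := Model n)
    (mfderiv 𝓘(ℝ, Model n) 𝓘(ℝ, Model n) e (e.symm x))
    (ContinuousLinearMap.comp (M₁ := Model n) (M₂ := Model n) (S.J (e.symm x))
      (mfderiv 𝓘(ℝ, Model n) 𝓘(ℝ, Model n) e.symm x))

theorem cplxL_apply (x v : Model n) : S.cplxL e x v = S.cplx e x v := rfl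

theorem contMDiffOn_ofChart (he : e ∈ IsManifold.maximalAtlas 𝓘(ℝ, Model n) ∞ M) (v : Model n) :
    ContMDiffOn 𝓘(ℝ, Model n) 𝓘(ℝ, Model n).tangent ∞
      (fun x ↦ (⟨e.symm x, ofChart e x v⟩ : TangentBundle 𝓘(ℝ, Model n) M)) e.target := by
  have h := (contMDiffOn_symm_of_mem_maximalAtlas he).contMDiffOn_tangentMapWithin
    (m := ∞) (by simp) e.open_target.uniqueMDiffOn
  have hv : ContMDiffOn 𝓘(ℝ, Model n) 𝓘(ℝ, Model n).tangent ∞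
      (fun x ↦ (⟨x, v⟩ : TangentBundle 𝓘(ℝ, Model n) (Model n))) e.target :=
    contMDiffOn_vectorSpace_iff_contDiffOn.2 contDiffOn_const
  refine (h.comp hv fun x hx ↦ hx).congr fun x hx ↦ ?_
  simp only [Function.comp_apply, tangentMapWithin, ofChart]
  rw [mfderivWithin_of_isOpen e.open_target hx]

theorem contDiffOn_metricL (he : e ∈ IsManifold.maximalAtlas 𝓘(ℝ, Model n) ∞ M) :
    ContDiffOn ℝ ∞ (S.metricL e) e.target := by
  refine contDiffOn_clm_apply.2 fun u ↦ contDiffOn_clm_apply.2 fun v ↦ ?_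
  refine ContMDiffOn.contDiffOn fun x hx ↦ ?_
  have hg := (S.contMDiff_g.contMDiffOn (s := Set.univ)).comp
    (contMDiffOn_symm_of_mem_maximalAtlas he) fun x hx ↦ Set.mem_univ _
  have h := ContMDiffWithinAt.clm_bundle_apply₂ (F₁ := Model n) (F₂ := Model n) (F₃ := ℝ)
    (E₁ := fun p : M ↦ TangentSpace 𝓘(ℝ, Model n) p)
    (E₂ := fun p : M ↦ TangentSpace 𝓘(ℝ, Model n) p) (E₃ := Bundle.Trivial M ℝ)
    (hg x hx) (contMDiffOn_ofChart he u x hx) (contMDiffOn_ofChart he v x hx)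
  simp only [Bundle.contMDiffWithinAt_totalSpace] at h
  exact h.2

theorem contDiffOn_cplxL (he : e ∈ IsManifold.maximalAtlas 𝓘(ℝ, Model n) ∞ M) :
    ContDiffOn ℝ ∞ (S.cplxL e) e.target := by
  refine contDiffOn_clm_apply.2 fun v ↦ ?_
  have hJ := (S.contMDiff_J.contMDiffOn (s := Set.univ)).comp
    (contMDiffOn_symm_of_mem_maximalAtlas he) fun x hx ↦ Set.mem_univ _
  have h : ContMDiffOn 𝓘(ℝ, Model n) 𝓘(ℝ, Model n).tangent ∞
      (fun x ↦ (⟨e.symm x, S.J (e.symm x) (ofChart e x v)⟩ : TangentBundle 𝓘(ℝ, Model n) M))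
      e.target := fun x hx ↦
    ContMDiffWithinAt.clm_bundle_apply (F₁ := Model n) (F₂ := Model n)
      (E₁ := fun p : M ↦ TangentSpace 𝓘(ℝ, Model n) p)
      (E₂ := fun p : M ↦ TangentSpace 𝓘(ℝ, Model n) p)
      (hJ x hx) (contMDiffOn_ofChart he v x hx)
  have h' := ((contMDiffOn_of_mem_maximalAtlas he).contMDiffOn_tangentMapWithin
    (m := ∞) (by simp) e.open_source.uniqueMDiffOn).comp h fun x hx ↦ e.map_target hx
  refine contMDiffOn_vectorSpace_iff_contDiffOn.1 (h'.congr fun x hx ↦ ?_)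
  simp only [Function.comp_apply, tangentMapWithin]
  rw [mfderivWithin_of_isOpen e.open_source (e.map_target hx), e.right_inv hx]
  rfl

end AlmostComplexNorden

/-! ### Inverse Gram matrices: smoothness and symmetry -/

section Gram
variable {E : Type*} [NormedAddCommGroup E] [NormedSpace ℝ E]
  {ι : Type*} [Fintype ι] [DecidableEq ι]

theorem contDiffOn_det {A : E → Matrix ι ι ℝ} {U : Set E} {m : WithTop ℕ∞}
    (hA : ∀ i j, ContDiffOn ℝ m (fun x ↦ A x i j) U) : ContDiffOn ℝ m (fun x ↦ (A x).det) U := by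
  simp only [Matrix.det_apply]
  exact ContDiffOn.sum fun σ _ ↦ (contDiffOn_prod fun i _ ↦ hA _ _).const_smul _

/-- Cramer's rule: the entries are quotients of determinants with smooth entries. -/
theorem contDiffOn_inv_apply {A : E → Matrix ι ι ℝ} {U : Set E} {m : WithTop ℕ∞}
    (hA : ∀ i j, ContDiffOn ℝ m (fun x ↦ A x i j) U) (hdet : ∀ x ∈ U, (A x).det ≠ 0) (i j : ι) :
    ContDiffOn ℝ m (fun x ↦ (A x)⁻¹ i j) U := by
  simp only [Matrix.inv_def, Ring.inverse_eq_inv', Matrix.smul_apply, Matrix.adjugate_apply,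
    smul_eq_mul]
  refine ((contDiffOn_det hA).inv hdet).mul (contDiffOn_det fun k l ↦ ?_)
  by_cases hk : k = j
  · subst hk
    simpa using contDiffOn_const
  · simpa [Matrix.updateRow_ne hk] using hA k l

set_option maxSynthPendingDepth 3 in
theorem contDiffOn_fderiv_apply_apply {U : Set E} (hU : IsOpen U) {g : E → E →L[ℝ] E →L[ℝ] ℝ}
    (hg : ContDiffOn ℝ ∞ g U) (u v w : E) : ContDiffOn ℝ ∞ (fun x ↦ fderiv ℝ g x u v w) U := by
  have hd : ContDiffOn ℝ ∞ (fderiv ℝ g) U := hg.fderiv_of_isOpen hU (by simp)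
  exact ((hd.clm_apply contDiffOn_const).clm_apply contDiffOn_const).clm_apply contDiffOn_const

variable {b : Module.Basis ι ℝ E} {B : E →L[ℝ] E →L[ℝ] ℝ}

theorem apply_eq_sum_repr (b : Module.Basis ι ℝ E) (B : E →L[ℝ] E →L[ℝ] ℝ) (v w : E) :
    B v w = ∑ k, b.repr v k * B (b k) w := by
  conv_lhs => rw [← b.sum_repr v]
  simp only [map_sum, map_smul, FunLike.coe_sum, FunLike.coe_smul, Finset.sum_apply,
    Pi.smul_apply, smul_eq_mul]

/-- A kernel vector of the Gram matrix gives the coefficients of a vector orthogonal to the whole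
basis. -/
theorem det_gram_ne_zero (hB : ∀ v, (∀ w, B v w = 0) → v = 0) (hs : ∀ v w, B v w = B w v) :
    (Matrix.of fun k l ↦ B (b k) (b l)).det ≠ 0 := by
  intro h
  obtain ⟨c, hc, hc0⟩ := Matrix.exists_vecMul_eq_zero_iff.2 h
  have hv : ∑ k, c k • b k = 0 := by
    refine hB _ fun w ↦ ?_
    rw [hs, apply_eq_sum_repr b]
    refine Finset.sum_eq_zero fun l _ ↦ ?_
    rw [hs]
    have := congrFun hc0 l
    simp only [Matrix.vecMul, dotProduct, Matrix.of_apply, Pi.zero_apply] at this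
    simp only [map_sum, map_smul, FunLike.coe_sum, FunLike.coe_smul, Finset.sum_apply, Pi.smul_apply,
      smul_eq_mul, this, mul_zero]
  exact hc (funext fun k ↦ Fintype.linearIndependent_iff.1 b.linearIndependent c hv k)

theorem isInverseGram_inv [FiniteDimensional ℝ E] (hB : ∀ v, (∀ w, B v w = 0) → v = 0)
    (hs : ∀ v w, B v w = B w v) :
    IsInverseGram b B fun i j ↦ (Matrix.of fun k l ↦ B (b k) (b l))⁻¹ i j := by
  have hdet : IsUnit (Matrix.of fun k l ↦ B (b k) (b l)).det :=
    (det_gram_ne_zero (b := b) hB hs).isUnit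
  have hT : (Matrix.of fun k l ↦ B (b k) (b l)).transpose = Matrix.of fun k l ↦ B (b k) (b l) := by
    ext i j; exact hs _ _
  refine ⟨fun i j ↦ ?_, fun v i ↦ ?_⟩
  · conv_lhs => rw [← hT, ← Matrix.transpose_nonsing_inv, Matrix.transpose_apply]
  · have h : (Matrix.of fun k l ↦ B (b k) (b l))⁻¹.mulVec
        ((Matrix.of fun k l ↦ B (b k) (b l)).mulVec (b.repr v)) = b.repr v := by
      rw [Matrix.mulVec_mulVec, Matrix.nonsing_inv_mul _ hdet, Matrix.one_mulVec]
    rw [← congrFun h i]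
    simp only [Matrix.mulVec, dotProduct, Matrix.of_apply]
    refine Finset.sum_congr rfl fun j _ ↦ ?_
    rw [apply_eq_sum_repr b B v]
    simp only [hs (b j), mul_comm]

end Gram

/-! ### The Levi-Civita connection in a chart and the transfer of the local identities -/

namespace AlmostComplexNorden

variable {n : ℕ} {M : Type*} [TopologicalSpace M] [ChartedSpace (Model n) M]
  [IsManifold 𝓘(ℝ, Model n) ∞ M] (S : AlmostComplexNorden n M)
  {e : OpenPartialHomeomorph M (Model n)}

/-- The coordinate basis of `ℝ²ⁿ`. -/
def stdBasis (n : ℕ) : Module.Basis (Fin (2 * n)) ℝ (Model n) :=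
  (EuclideanSpace.basisFun (Fin (2 * n)) ℝ).toBasis

theorem stdBasis_apply (i : Fin (2 * n)) : stdBasis n i = vec i := by
  simp [stdBasis, vec]

theorem metricL_symm (x u v : Model n) : S.metricL e x u v = S.metricL e x v u := S.symm _ _ _

theorem metricL_nondegenerate (he : e ∈ IsManifold.maximalAtlas 𝓘(ℝ, Model n) ∞ M) {x : Model n}
    (hx : x ∈ e.target) (v : Model n) (h : ∀ w, S.metricL e x v w = 0) : v = 0 := by
  have h0 : ofChart e x v = 0 := S.nondegenerate _ _ fun w ↦ by
    rw [← ofChart_toChart he hx w]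
    exact h _
  rw [← toChart_ofChart he hx v, h0]
  exact map_zero (mfderiv 𝓘(ℝ, Model n) 𝓘(ℝ, Model n) e (e.symm x))

theorem cplxL_sq (he : e ∈ IsManifold.maximalAtlas 𝓘(ℝ, Model n) ∞ M) {x : Model n}
    (hx : x ∈ e.target) : S.cplxL e x * S.cplxL e x = -1 := by
  refine ContinuousLinearMap.ext fun v ↦ ?_
  change toChart e x (S.J _ (ofChart e x (toChart e x (S.J _ (ofChart e x v))))) = -v
  rw [ofChart_toChart he hx, S.J_sq]
  conv_rhs => rw [← toChart_ofChart he hx v]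
  exact map_neg (mfderiv 𝓘(ℝ, Model n) 𝓘(ℝ, Model n) e (e.symm x)) _

/-- The Norden condition for the pair `v, J w`, combined with `J² = -1`. -/
theorem metricL_cplxL (he : e ∈ IsManifold.maximalAtlas 𝓘(ℝ, Model n) ∞ M) {x : Model n}
    (hx : x ∈ e.target) (v w : Model n) :
    S.metricL e x (S.cplxL e x v) w = S.metricL e x v (S.cplxL e x w) := by
  change S.g _ (ofChart e x (toChart e x (S.J _ (ofChart e x v)))) (ofChart e x w)
    = S.g _ (ofChart e x v) (ofChart e x (toChart e x (S.J _ (ofChart e x w))))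
  rw [ofChart_toChart he hx, ofChart_toChart he hx]
  have h := S.norden _ (ofChart e x v) (S.J _ (ofChart e x w))
  rw [S.J_sq, map_neg] at h
  exact neg_injective h

theorem isInverseGram_invMetric (he : e ∈ IsManifold.maximalAtlas 𝓘(ℝ, Model n) ∞ M) {x : Model n}
    (hx : x ∈ e.target) : IsInverseGram (stdBasis n) (S.metricL e x) (S.invMetric e x) := by
  have h := isInverseGram_inv (b := stdBasis n) (S.metricL_nondegenerate he hx)
    (S.metricL_symm x)
  simp only [stdBasis_apply] at h
  exact h

theorem contDiffOn_invMetric (he : e ∈ IsManifold.maximalAtlas 𝓘(ℝ, Model n) ∞ M)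
    (i j : Fin (2 * n)) : ContDiffOn ℝ ∞ (fun x ↦ S.invMetric e x i j) e.target := by
  refine contDiffOn_inv_apply (A := fun x ↦ Matrix.of fun k l ↦ S.metric e x (vec k) (vec l))
    (fun k l ↦ ?_) (fun x hx ↦ ?_) i j
  · exact ((S.contDiffOn_metricL he).clm_apply contDiffOn_const).clm_apply contDiffOn_const
  · have h := det_gram_ne_zero (b := stdBasis n) (S.metricL_nondegenerate he hx) (S.metricL_symm x)
    simp only [stdBasis_apply] at h
    exact h

/-- The linear form `w ↦ ½ (∂_u g(v, w) + ∂_v g(u, w) - ∂_w g(u, v))`. -/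
def koszul (e : OpenPartialHomeomorph M (Model n)) (x u v : Model n) : Model n →L[ℝ] ℝ :=
  (1 / 2 : ℝ) • (fderiv ℝ (S.metricL e) x u v + fderiv ℝ (S.metricL e) x v u
    - ((fderiv ℝ (S.metricL e) x).flip u).flip v)

theorem koszul_apply (x u v w : Model n) : S.koszul e x u v w = 1 / 2 *
    (fderiv ℝ (S.metricL e) x u v w + fderiv ℝ (S.metricL e) x v u w
      - fderiv ℝ (S.metricL e) x w u v) := rfl

/-- The Christoffel symbols as a field of continuous bilinear maps. -/
def christoffelL (e : OpenPartialHomeomorph M (Model n)) (x : Model n) :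
    Model n →L[ℝ] Model n →L[ℝ] Model n :=
  (LinearMap.mk₂ ℝ
    (fun u v ↦ ∑ k, ∑ l, (S.invMetric e x k l * S.koszul e x u v (stdBasis n l)) • stdBasis n k)
    (fun u u' v ↦ by
      simp only [← Finset.sum_add_distrib, ← add_smul, koszul_apply, map_add, add_apply]
      exact Finset.sum_congr rfl fun k _ ↦ Finset.sum_congr rfl fun l _ ↦ by congr 1; ring)
    (fun c u v ↦ by
      simp only [Finset.smul_sum, smul_smul, koszul_apply, map_smul, FunLike.coe_smul,
        Pi.smul_apply, smul_eq_mul]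
      exact Finset.sum_congr rfl fun k _ ↦ Finset.sum_congr rfl fun l _ ↦ by congr 1; ring)
    (fun u v v' ↦ by
      simp only [← Finset.sum_add_distrib, ← add_smul, koszul_apply, map_add, add_apply]
      exact Finset.sum_congr rfl fun k _ ↦ Finset.sum_congr rfl fun l _ ↦ by congr 1; ring)
    (fun c u v ↦ by
      simp only [Finset.smul_sum, smul_smul, koszul_apply, map_smul, FunLike.coe_smul,
        Pi.smul_apply, smul_eq_mul]
      exact Finset.sum_congr rfl fun k _ ↦ Finset.sum_congr rfl fun l _ ↦ by congr 1; ring)).toContinuousBilinearMap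

theorem christoffelL_apply (x u v : Model n) : S.christoffelL e x u v
    = ∑ k, ∑ l, (S.invMetric e x k l * S.koszul e x u v (stdBasis n l)) • stdBasis n k := rfl

theorem differentiableAt_metricL (he : e ∈ IsManifold.maximalAtlas 𝓘(ℝ, Model n) ∞ M) {x : Model n}
    (hx : x ∈ e.target) : DifferentiableAt ℝ (S.metricL e) x :=
  ((S.contDiffOn_metricL he).contDiffAt (e.open_target.mem_nhds hx)).differentiableAt (by simp)

theorem fderiv_metric (he : e ∈ IsManifold.maximalAtlas 𝓘(ℝ, Model n) ∞ M) {x : Model n}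
    (hx : x ∈ e.target) (u v w : Model n) :
    fderiv ℝ (fun y ↦ S.metric e y v w) x u = fderiv ℝ (S.metricL e) x u v w := by
  have h := S.differentiableAt_metricL he hx
  simp only [← metricL_apply]
  rw [LocalNorden.fderiv_apply_const (f := fun y ↦ S.metricL e y v) (by fun_prop),
    LocalNorden.fderiv_apply_const h]

theorem fderiv_metricL_symm (he : e ∈ IsManifold.maximalAtlas 𝓘(ℝ, Model n) ∞ M) {x : Model n}
    (hx : x ∈ e.target) (u v w : Model n) :
    fderiv ℝ (S.metricL e) x u v w = fderiv ℝ (S.metricL e) x u w v := by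
  simp only [← S.fderiv_metric he hx, ← metricL_apply, S.metricL_symm _ v w]

theorem christoffelL_eq (he : e ∈ IsManifold.maximalAtlas 𝓘(ℝ, Model n) ∞ M) {x : Model n}
    (hx : x ∈ e.target) (u v : Model n) : S.christoffelL e x u v = S.christoffel e x u v := by
  simp only [christoffelL_apply, christoffel, koszul_apply, S.fderiv_metric he hx, stdBasis_apply]
  exact Finset.sum_congr rfl fun k _ ↦ Finset.sum_congr rfl fun l _ ↦ by congr 1; ring

theorem contDiffOn_christoffelL (he : e ∈ IsManifold.maximalAtlas 𝓘(ℝ, Model n) ∞ M) :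
    ContDiffOn ℝ ∞ (S.christoffelL e) e.target := by
  have hd' : ∀ u v w : Model n,
      ContDiffOn ℝ ∞ (fun x ↦ fderiv ℝ (S.metricL e) x u v w) e.target :=
    contDiffOn_fderiv_apply_apply e.open_target (S.contDiffOn_metricL he)
  refine contDiffOn_clm_apply.2 fun u ↦ contDiffOn_clm_apply.2 fun v ↦ ?_
  simp only [christoffelL_apply, koszul_apply]
  exact ContDiffOn.sum fun k _ ↦ ContDiffOn.sum fun l _ ↦
    ((S.contDiffOn_invMetric he k l).mul (contDiffOn_const.mul
      (((hd' _ _ _).add (hd' _ _ _)).sub (hd' _ _ _)))).smul contDiffOn_const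

theorem metricL_christoffelL (he : e ∈ IsManifold.maximalAtlas 𝓘(ℝ, Model n) ∞ M) {x : Model n}
    (hx : x ∈ e.target) (u v w : Model n) :
    S.metricL e x (S.christoffelL e x u v) w = S.koszul e x u v w :=
  (S.isInverseGram_invMetric he hx).apply_sum_smul (S.metricL_symm x) _ w

/-- The almost complex structure with Norden metric in a chart. -/
def toLocal (he : e ∈ IsManifold.maximalAtlas 𝓘(ℝ, Model n) ∞ M) : LocalNorden e.target where
  g := S.metricL e
  J := S.cplxL e
  Γ := S.christoffelL e
  isOpen := e.open_target
  contDiffOn_g := S.contDiffOn_metricL he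
  contDiffOn_J := S.contDiffOn_cplxL he
  contDiffOn_Γ := S.contDiffOn_christoffelL he
  symm _ _ := S.metricL_symm _
  nondegenerate _ hx := S.metricL_nondegenerate he hx
  J_sq _ hx := S.cplxL_sq he hx
  selfAdjoint_J _ hx := S.metricL_cplxL he hx
  torsionFree x hx u v := by
    have h : S.koszul e x u v = S.koszul e x v u := by
      ext w
      rw [koszul_apply, koszul_apply, S.fderiv_metricL_symm he hx w u v]
      ring
    rw [christoffelL_apply, christoffelL_apply, h]
  compat x hx u v w := by
    -- In the sum of the two Koszul forms everything cancels except twice `½ ∂_u g(v, w)`.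
    rw [S.metricL_christoffelL he hx, S.metricL_symm x v, S.metricL_christoffelL he hx,
      koszul_apply, koszul_apply, S.fderiv_metricL_symm he hx u w v,
      S.fderiv_metricL_symm he hx w u v, S.fderiv_metricL_symm he hx v u w]
    ring

theorem toLocal_nablaJ (he : e ∈ IsManifold.maximalAtlas 𝓘(ℝ, Model n) ∞ M) {x : Model n}
    (hx : x ∈ e.target) (u v : Model n) : (S.toLocal he).nablaJ x u v = S.nablaJ e x u v := by
  have h := LocalNorden.fderiv_apply_const ((S.toLocal he).hasFDerivAt_J hx).differentiableAt v u
  simp only [nablaJ, ← S.christoffelL_eq he hx, ← cplxL_apply]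
  exact congrArg (· + _ - _) h.symm

theorem toLocal_curv (he : e ∈ IsManifold.maximalAtlas 𝓘(ℝ, Model n) ∞ M) {x : Model n}
    (hx : x ∈ e.target) (u v w : Model n) :
    (S.toLocal he).curv x u v w = S.curvature e x u v w := by
  have hΓ := ((S.toLocal he).hasFDerivAt_Γ hx).differentiableAt
  have h : ∀ u v w, fderiv ℝ (fun y ↦ S.christoffel e y v w) x u
      = fderiv ℝ (S.toLocal he).Γ x u v w := fun u v w ↦ by
    have hev : (fun y ↦ S.christoffel e y v w) =ᶠ[nhds x] fun y ↦ (S.toLocal he).Γ y v w :=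
      Filter.mem_of_superset (e.open_target.mem_nhds hx) fun y hy ↦
        (S.christoffelL_eq he hy v w).symm
    rw [hev.fderiv_eq, LocalNorden.fderiv_apply_const (f := fun y ↦ (S.toLocal he).Γ y v)
      (by fun_prop), LocalNorden.fderiv_apply_const hΓ]
  simp only [curvature, h, ← S.christoffelL_eq he hx]
  change fderiv ℝ (S.toLocal he).Γ x u v w - fderiv ℝ (S.toLocal he).Γ x v u w
    + S.christoffelL e x u (S.christoffelL e x v w)
    - S.christoffelL e x v (S.christoffelL e x u w) = _
  abel

theorem IsW3.cyclic {S : AlmostComplexNorden n M} (hW : S.IsW3)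
    (he : e ∈ IsManifold.maximalAtlas 𝓘(ℝ, Model n) ∞ M) : (S.toLocal he).Cyclic := by
  intro x hx u v w
  have h := hW e he _ (e.map_target hx) u v w
  rw [e.right_inv hx] at h
  simp only [S.toLocal_nablaJ he hx]
  exact h

/-- On a quasi-Kähler manifold with Norden metric, `‖∇J‖² = -2 (τ + τ**)`. -/
theorem IsW3.sqNormNablaJ_eq {S : AlmostComplexNorden n M} (hW : S.IsW3)
    (he : e ∈ IsManifold.maximalAtlas 𝓘(ℝ, Model n) ∞ M) {x : Model n} (hx : x ∈ e.target) :
    S.sqNormNablaJ e x = -2 * (S.tau e x + S.tauStarStar e x) := by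
  have hD := hW.cyclic he
  have hgi := S.isInverseGram_invMetric he hx
  have h₁ := (S.toLocal he).sqNorm_nablaJ hD hx hgi
  -- The Lee form must vanish on the whole chart image, not only at `x`, because it is
  -- differentiated.
  have h₂ := (S.toLocal he).sum_curv_add
    (fun y hy ↦ hD.traceL_flip_nablaJ hy (S.isInverseGram_invMetric he hy)) hx hgi
  rw [← h₂] at h₁
  simp only [S.toLocal_nablaJ he hx, S.toLocal_curv he hx, stdBasis_apply, mul_add,
    Finset.sum_add_distrib] at h₁
  have hτ : S.tau e x = ∑ i, ∑ j, ∑ k, ∑ l, S.invMetric e x i j * S.invMetric e x k l *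
      S.curvature₄ e x (vec i) (vec k) (vec l) (vec j) := by
    rw [sum_comm_pairs]
    simp only [tau, ricci, Finset.mul_sum]
    exact Finset.sum_congr rfl fun k _ ↦ Finset.sum_congr rfl fun l _ ↦
      Finset.sum_congr rfl fun i _ ↦ Finset.sum_congr rfl fun j _ ↦ by ring
  rw [hτ, mul_add]
  exact h₁

end AlmostComplexNorden

end Norden

end

theorem mainTheorem8 (n : ℕ) (M : Type*) [TopologicalSpace M]
    [ChartedSpace (Norden.Model n) M] [IsManifold 𝓘(ℝ, Norden.Model n) ∞ M]
    (S : Norden.AlmostComplexNorden n M) (hW : S.IsW3) (hK : S.IsIsotropicKahler) :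
    ∀ e ∈ IsManifold.maximalAtlas 𝓘(ℝ, Norden.Model n) ∞ M, ∀ p ∈ e.source,
      S.tauStarStar e (e p) = -S.tau e (e p) := by
  intro e he p hp
  have h := hW.sqNormNablaJ_eq he (e.map_source hp)
  rw [hK e he p hp] at h
  linarith
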